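/- Consider four spins $\mathbf{s}_0,\mathbf{s}_1,\mathbf{s}_2,\mathbf{s}_3$ with spin quantum number $s=\tfrac12$, acting on $\mathcal H=(\mathbb C^2)^{\otimes 4}$ and grouped into the $N=2$ dimers $\{0,1\}$ and $\{2,3\}$. For a real $4\times4$ matrix $\mathbb J=(J_{\mu\nu})$ let $H(\mathbb J)=\sum_{\mu,\nu=0}^{3}J_{\mu\nu}\,\mathbf{s}_\mu\cdot\mathbf{s}_\nu$, and let $\Phi=[0,1]\otimes[2,3]$, where $[\mu,\nu]=\tfrac{1}{\sqrt2}\left(|\tfrac12,-\tfrac12\rangle-|-\tfrac12,\tfrac12\rangle\right)$ is the normalized ground state of $\mathbf{s}_\mu\cdot\mathbf{s}_\nu$. The system $\mathbb J$ is called DGS (it has a dimerized ground state), written $\mathbb J\in\mathcal C_\Phi$, if $\langle\Phi|H(\mathbb J)\Phi\rangle\le\langle\Psi|H(\mathbb J)\Psi\rangle$ for all $\Psi\in\mathcal H$ with $\|\Psi\|=1$. Let $\mathcal J_\Phi$ be the space of all real symmetric traceless $4\times 4$ matrices $\mathbb J$ whose row sums $\sum_\nu J_{\mu\nu}$ do not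 depend on $\mu$ and which satisfy the balance condition $J_{02}+J_{13}=J_{03}+J_{12}$. **Proposition 4.** Let $\mathbb J\in\mathcal J_\Phi$. Then $\mathbb J\in\mathcal C_\Phi$ if and only if the following four inequalities hold: $$J_{01}+J_{23}-J_{02}-J_{13}\ge0,$$ $$2(J_{01}+J_{23})+J_{02}+J_{13}\ge0,$$ $$2J_{01}^2J_{23}-(J_{12}-J_{13})^2J_{23}-J_{01}\left((J_{02}-J_{12})^2+(J_{02}+J_{13})J_{23}-2J_{23}^2\right)\ge0,$$ $$2\left(J_{01}^2+J_{12}(J_{02}+J_{13})+J_{23}^2\right)-J_{02}^2-2J_{12}^2-J_{13}^2-J_{01}(J_{02}+J_{13}-6J_{23})-(J_{02}+J_{13})J_{23}\ge0.$$ Moreover, put $p_1=J_{01}+J_{23}$, $p_2=J_{02}+J_{13}$, $p_3=J_{12}-\tfrac{p_2}{2}$, $p_4=J_{02}-\tfrac{p_2}{2}$, $p_5=J_{01}$ and $R=\sqrt{(2p_1^2-p_1p_2-4p_3^2)(2p_1^2-p_1p_2-4p_4^2)}$. Then the four inequalities are equivalent to the following system: $$0\le p_1,\qquad -2p_1\le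 p_2\le p_1,\qquad -\tfrac12\sqrt{p_1(2p_1-p_2)}\le p_3,\,p_4\le\tfrac12\sqrt{p_1(2p_1-p_2)},$$ $$\frac{p_1}{2}+\frac{1}{2p_1-p_2}\left(2p_3p_4-\tfrac12R\right)\le p_5\le\frac{p_1}{2}+\frac{1}{2p_1-p_2}\left(2p_3p_4+\tfrac12R\right),$$ where, in the case $p_1=0$ (in which the preceding inequalities force $p_2=p_3=p_4=R=0$), the quotients $0/0$ in the last line are read as $0$. -/

import Mathlib

noncomputable section

namespace SpinDimers

/-- The spins of a system of `N` dimers: `(i, δ)` is the spin `δ ∈ {0, 1}` of the dimer `i`. -/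
abbrev Site (N : ℕ) : Type := Fin N × Fin 2

/-- Labels of the product basis `⨂_μ |m_μ⟩` of spin-1/2 states. At every site the value `0`
stands for `m = +1/2` and the value `1` stands for `m = -1/2`. -/
abbrev Config (N : ℕ) : Type := Site N → Fin 2

/-- The Hilbert space `⨂_μ ℂ²` of `2N` spins 1/2, of dimension `2 ^ (2N)`, in coordinates
with respect to the orthonormal product basis. -/
abbrev State (N : ℕ) : Type := EuclideanSpace ℂ (Config N)

/-- The three spin matrices of a single spin 1/2 (one half of the Pauli matrices), in the
basis `|+1/2⟩, |-1/2⟩`. -/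
def spinMatrix : Fin 3 → Matrix (Fin 2) (Fin 2) ℂ :=
  ![!![0, 1 / 2; 1 / 2, 0],
    !![0, -Complex.I / 2; Complex.I / 2, 0],
    !![1 / 2, 0; 0, -1 / 2]]

/-- The operator on the full Hilbert space that acts as the `2 × 2` matrix `A` on the tensor
factor of the site `μ` and as the identity on all other factors. -/
def siteOp {N : ℕ} (A : Matrix (Fin 2) (Fin 2) ℂ) (μ : Site N) : State N →ₗ[ℂ] State N where
  toFun ψ := WithLp.toLp 2 fun σ => ∑ a : Fin 2, A (σ μ) a * ψ (Function.update σ μ a)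
  map_add' ψ φ := by
    ext σ
    simp [mul_add]
    ring
  map_smul' c ψ := by
    ext σ
    simp
    ring

/-- The component `k` of the spin observable at the site `μ`. -/
def spin {N : ℕ} (k : Fin 3) (μ : Site N) : State N →ₗ[ℂ] State N :=
  siteOp (spinMatrix k) μ

/-- The operator `s_μ · s_ν`. -/
def spinDot {N : ℕ} (μ ν : Site N) : State N →ₗ[ℂ] State N :=
  ∑ k : Fin 3, spin k μ ∘ₗ spin k ν

/-- The Heisenberg Hamiltonian `H(J) = ∑_{μ, ν} J_{μν} s_μ · s_ν`; the sum runs over all ordered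
pairs, including `μ = ν`. -/
def hamiltonian {N : ℕ} (J : Matrix (Site N) (Site N) ℝ) : State N →ₗ[ℂ] State N :=
  ∑ μ : Site N, ∑ ν : Site N, (J μ ν : ℂ) • spinDot μ ν

/-- The coordinates of `[i0, i1] = (|+1/2, -1/2⟩ - |-1/2, +1/2⟩) / √2`, the ground state of the
antiferromagnetic dimer `s_{i0} · s_{i1}`. -/
def singlet : Matrix (Fin 2) (Fin 2) ℂ :=
  !![0, 1 / (Real.sqrt 2 : ℂ); -1 / (Real.sqrt 2 : ℂ), 0]

/-- The dimerized state `Φ = ⨂_i [i0, i1]`. -/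
def dimerizedState (N : ℕ) : State N :=
  WithLp.toLp 2 fun σ => ∏ i : Fin N, singlet (σ (i, 0)) (σ (i, 1))

/-- The expectation value `⟨Ψ | H(J) Ψ⟩`. -/
def energy {N : ℕ} (J : Matrix (Site N) (Site N) ℝ) (Ψ : State N) : ℝ :=
  (inner ℂ Ψ (hamiltonian J Ψ)).re

/-- The set `C_Φ` of the systems with dimerized ground state, for the spin quantum number 1/2. -/
def dgsSystems (N : ℕ) : Set (Matrix (Site N) (Site N) ℝ) :=
  {J | ∀ Ψ : State N, ‖Ψ‖ = 1 → energy J (dimerizedState N) ≤ energy J Ψ}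

/-- The space `J_Φ` of the real, symmetric, traceless coupling matrices all of whose row sums are
equal and which are balanced between any two dimers. -/
def balancedSystems (N : ℕ) : Set (Matrix (Site N) (Site N) ℝ) :=
  {J | J.IsSymm ∧ J.trace = 0 ∧ (∀ μ μ' : Site N, ∑ ν, J μ ν = ∑ ν, J μ' ν) ∧
    ∀ i j : Fin N, i < j →
      J (i, 0) (j, 0) + J (i, 1) (j, 1) = J (i, 0) (j, 1) + J (i, 1) (j, 0)}

end SpinDimers

end

/-! Four spins 1/2 decompose into one quintet, three components of a twofold spin-one multiplicity
space enlarged to dimension three, and two singlets. Balance decouples Φ from the other singlet, so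
the energy above Φ is a sum of three blocks (`realEnergy_add_eq`): multiples of squares for the
quintet and the other singlet, giving the two linear inequalities, and one ternary form repeated for
the three magnetic components. For that form the trace is already nonnegative, so semidefiniteness
amounts to the signs of the other two coefficients of its characteristic polynomial
(`tripletForm_nonneg_iff`). The cubic one is a concave quadratic in `p5`, and solving it gives the
interval (`invariants_nonneg_iff_parametric`). -/

namespace SpinDimers

/-! ### Semidefiniteness of the triplet block -/

section Algebra

/-- The quadratic form of the energy above the dimerized state on the spin-one sector. -/
def tripletForm (x y z u v A B C : ℝ) : ℝ :=
  y * A ^ 2 + x * B ^ 2 + z * C ^ 2 + 2 * C * (u * A + v * B)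

theorem minors_nonneg_of_tripletForm_nonneg {x y z u v : ℝ}
    (h : ∀ A B C, 0 ≤ tripletForm x y z u v A B C) :
    0 ≤ x ∧ 0 ≤ y ∧ 0 ≤ z ∧ u ^ 2 ≤ y * z ∧ v ^ 2 ≤ x * z ∧
      0 ≤ x * y * z - u ^ 2 * x - v ^ 2 * y := by
  have minor : ∀ a b c : ℝ, 0 ≤ a → 0 ≤ c →
      (∀ s t : ℝ, 0 ≤ a * s ^ 2 + c * t ^ 2 + 2 * t * (b * s)) → b ^ 2 ≤ a * c := by
    intro a b c ha hc hq
    rcases hc.eq_or_lt with rfl | hc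
    · have h1 := hq (-(a + 1) * b) (a ^ 2 + 1)
      -- With `c = 0` this evaluates to `-(a + 2) * b ^ 2`, forcing `b = 0`.
      have h2 := hq b (-(a + 1))
      nlinarith [sq_nonneg b]
    · have h1 := hq c (-b)
      have h2 : 0 ≤ c * (a * c - b ^ 2) := by nlinarith
      linarith [nonneg_of_mul_nonneg_right h2 hc]
  have hx : 0 ≤ x := by simpa [tripletForm] using h 0 1 0
  have hy : 0 ≤ y := by simpa [tripletForm] using h 1 0 0
  have hz : 0 ≤ z := by simpa [tripletForm] using h 0 0 1
  have hu : u ^ 2 ≤ y * z := minor y u z hy hz fun s t => by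
    simpa [tripletForm] using h s 0 t
  have hv : v ^ 2 ≤ x * z := minor x v z hx hz fun s t => by
    simpa [tripletForm] using h 0 s t
  refine ⟨hx, hy, hz, hu, hv, ?_⟩
  rcases hx.eq_or_lt with rfl | hx
  · have : v = 0 := by nlinarith
    simp [this]
  rcases hy.eq_or_lt with rfl | hy
  · have : u = 0 := by nlinarith
    simp [this]
  -- The minimizer over `A`, `B` at `C = x * y`; the value is `x * y` times the determinant.
  have h1 := h (-u * x) (-v * y) (x * y)
  have h2 : 0 ≤ (x * y) * (x * y * z - u ^ 2 * x - v ^ 2 * y) := by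
    unfold tripletForm at h1
    nlinarith
  exact nonneg_of_mul_nonneg_right h2 (mul_pos hx hy)

/-- If `x < 0 < y`, then `h3` forces `u ^ 2 ≥ z * y`, and this makes `h2` fail. In normalized
coordinates `C` carries a factor `√2` relative to `A` and `B`, so the expression in `h2` is twice
the sum of the principal 2 × 2 minors. -/
theorem diag_nonneg_of_invariants_nonneg {x y z u v : ℝ} (hxy : 0 < x + y) (hz : 0 < z)
    (h2 : 0 ≤ 2 * (x * y) + z * (x + y) - u ^ 2 - v ^ 2)
    (h3 : 0 ≤ x * y * z - u ^ 2 * x - v ^ 2 * y) : 0 ≤ x := by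
  by_contra! hx
  have hy : 0 < y := by linarith
  have h4 : 0 ≤ (-x) * (u ^ 2 - z * y) := by nlinarith [mul_nonneg (sq_nonneg v) hy.le]
  have h5 : 0 ≤ u ^ 2 - z * y := nonneg_of_mul_nonneg_right h4 (by linarith)
  nlinarith [sq_nonneg v, mul_pos (neg_pos.2 hx) hy, mul_pos (neg_pos.2 hx) hz]

theorem minors_nonneg_of_invariants_nonneg {x y z u v : ℝ} (hxy : 0 < x + y) (hz : 0 < z)
    (h2 : 0 ≤ 2 * (x * y) + z * (x + y) - u ^ 2 - v ^ 2)
    (h3 : 0 ≤ x * y * z - u ^ 2 * x - v ^ 2 * y) :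
    0 ≤ x ∧ 0 ≤ y ∧ u ^ 2 ≤ y * z ∧ v ^ 2 ≤ x * z := by
  have hx : 0 ≤ x := diag_nonneg_of_invariants_nonneg hxy hz h2 h3
  have hy : 0 ≤ y := diag_nonneg_of_invariants_nonneg (u := v) (v := u) (x := y) (y := x) (z := z)
    (by linarith) hz (by linarith) (by linarith)
  refine ⟨hx, hy, ?_, ?_⟩
  · rcases hx.eq_or_lt with rfl | hx
    · nlinarith [sq_nonneg v]
    · have : 0 ≤ x * (y * z - u ^ 2) := by nlinarith [mul_nonneg (sq_nonneg v) hy]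
      linarith [nonneg_of_mul_nonneg_right this hx]
  · rcases hy.eq_or_lt with rfl | hy
    · nlinarith [sq_nonneg u]
    · have : 0 ≤ y * (x * z - v ^ 2) := by nlinarith [mul_nonneg (sq_nonneg u) hx]
      linarith [nonneg_of_mul_nonneg_right this hy]

/-- Completing the square in `C` leaves the Schur complement `key`, a binary form whose determinant
is `z` times the expression in `h3`. -/
theorem tripletForm_nonneg {x y z u v : ℝ} (hxy : 0 < x + y) (hz : 0 < z)
    (h2 : 0 ≤ 2 * (x * y) + z * (x + y) - u ^ 2 - v ^ 2)
    (h3 : 0 ≤ x * y * z - u ^ 2 * x - v ^ 2 * y) (A B C : ℝ) :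
    0 ≤ tripletForm x y z u v A B C := by
  obtain ⟨hx, hy, hu, hv⟩ := minors_nonneg_of_invariants_nonneg hxy hz h2 h3
  have key : 0 ≤ (y * z - u ^ 2) * A ^ 2 + (x * z - v ^ 2) * B ^ 2 - 2 * (u * v) * (A * B) := by
    rcases hu.eq_or_lt with hu' | hu'
    · have : u * v = 0 := by
        have : (u * v) ^ 2 ≤ 0 := by nlinarith
        exact pow_eq_zero_iff two_ne_zero |>.1 (le_antisymm this (sq_nonneg _))
      rw [this]
      nlinarith [mul_nonneg (sub_nonneg.2 hv) (sq_nonneg B)]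
    · have hd : 0 < y * z - u ^ 2 := sub_pos.2 hu'
      refine nonneg_of_mul_nonneg_right (b := (y * z - u ^ 2) * A ^ 2 + (x * z - v ^ 2) * B ^ 2
        - 2 * (u * v) * (A * B)) ?_ hd
      have h4 := mul_nonneg (mul_nonneg hz.le h3) (sq_nonneg B)
      nlinarith [sq_nonneg ((y * z - u ^ 2) * A - u * v * B)]
  have h5 : 0 ≤ z * tripletForm x y z u v A B C := by
    unfold tripletForm
    nlinarith [sq_nonneg (z * C + (u * A + v * B))]
  exact nonneg_of_mul_nonneg_right h5 hz

theorem tripletForm_nonneg_iff {x y z u v : ℝ} (hxy : 0 ≤ x + y) (hz : x + y ≤ z)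
    (hz' : z ≤ 4 * (x + y)) :
    (∀ A B C, 0 ≤ tripletForm x y z u v A B C) ↔
      0 ≤ 2 * (x * y) + z * (x + y) - u ^ 2 - v ^ 2 ∧
        0 ≤ x * y * z - u ^ 2 * x - v ^ 2 * y := by
  constructor
  · intro h
    obtain ⟨hx, hy, -, hu, hv, h3⟩ := minors_nonneg_of_tripletForm_nonneg h
    exact ⟨by nlinarith [mul_nonneg hx hy], h3⟩
  · rintro ⟨h2, h3⟩ A B C
    rcases hxy.eq_or_lt with h0 | h0
    -- In the degenerate case `z` is squeezed to zero and `h2` becomes `-2x² - u² - v² ≥ 0`.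
    · have hz0 : z = 0 := by linarith
      obtain rfl : y = -x := by linarith
      have hx : x = 0 := by nlinarith [sq_nonneg x, sq_nonneg u, sq_nonneg v]
      have hu : u = 0 := by nlinarith [sq_nonneg x, sq_nonneg u, sq_nonneg v]
      have hv : v = 0 := by nlinarith [sq_nonneg x, sq_nonneg u, sq_nonneg v]
      simp [tripletForm, hx, hu, hv, hz0]
    · exact tripletForm_nonneg h0 (h0.trans_le hz) h2 h3 A B C

/-! ### The parametric description -/

theorem half_sqrt_bounds_iff {a p : ℝ} (ha : 0 ≤ a) :
    (-(1 / 2) * √a ≤ p ∧ p ≤ 1 / 2 * √a) ↔ 4 * p ^ 2 ≤ a := by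
  rw [show 4 * p ^ 2 = (2 * p) ^ 2 by ring, Real.sq_le ha]
  constructor <;> rintro ⟨h1, h2⟩ <;> constructor <;> linarith

theorem half_sqrt_interval_iff {z D m q p : ℝ} (hz : 0 < z) (hD : 0 ≤ D) :
    (q / 2 + 1 / z * (m - 1 / 2 * √D) ≤ p ∧ p ≤ q / 2 + 1 / z * (m + 1 / 2 * √D)) ↔
      (z * (2 * p - q) - 2 * m) ^ 2 ≤ D := by
  rw [Real.sq_le hD, ← le_sub_iff_add_le', ← sub_le_iff_le_add', one_div_mul_eq_div z,
    one_div_mul_eq_div z, div_le_iff₀ hz, le_div_iff₀ hz]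
  constructor <;> rintro ⟨h1, h2⟩ <;> constructor <;> linarith

/-- With `z = 2p1 - p2`, `4z` times the cubic expression equals `R² - (z(2p5 - p1) - 4p3p4)²`, where
`R²` is the product under the root. -/
theorem invariants_nonneg_iff_parametric {p1 p2 p3 p4 p5 : ℝ} (h1 : 0 ≤ p1) (h2 : p2 ≤ p1)
    (h3 : -2 * p1 ≤ p2) :
    (0 ≤ 2 * (p5 * (p1 - p5)) + (2 * p1 - p2) * p1 - (p4 - p3) ^ 2 - (p3 + p4) ^ 2 ∧
      0 ≤ p5 * (p1 - p5) * (2 * p1 - p2) - (p4 - p3) ^ 2 * p5 - (p3 + p4) ^ 2 * (p1 - p5)) ↔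
    ((-(1 / 2) * √(p1 * (2 * p1 - p2)) ≤ p3 ∧ p3 ≤ 1 / 2 * √(p1 * (2 * p1 - p2))) ∧
      (-(1 / 2) * √(p1 * (2 * p1 - p2)) ≤ p4 ∧ p4 ≤ 1 / 2 * √(p1 * (2 * p1 - p2))) ∧
      p1 / 2 + 1 / (2 * p1 - p2) * (2 * p3 * p4
        - 1 / 2 * √((2 * p1 ^ 2 - p1 * p2 - 4 * p3 ^ 2) * (2 * p1 ^ 2 - p1 * p2 - 4 * p4 ^ 2))) ≤ p5 ∧
      p5 ≤ p1 / 2 + 1 / (2 * p1 - p2) * (2 * p3 * p4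
        + 1 / 2 * √((2 * p1 ^ 2 - p1 * p2 - 4 * p3 ^ 2) *
          (2 * p1 ^ 2 - p1 * p2 - 4 * p4 ^ 2)))) := by
  rcases h1.eq_or_lt with rfl | hp1
  · obtain rfl : p2 = 0 := by linarith
    constructor
    · rintro ⟨h4, -⟩
      have hp3 : p3 = 0 := by nlinarith [sq_nonneg p3, sq_nonneg p4, sq_nonneg p5]
      have hp4 : p4 = 0 := by nlinarith [sq_nonneg p3, sq_nonneg p4, sq_nonneg p5]
      have hp5 : p5 = 0 := by nlinarith [sq_nonneg p3, sq_nonneg p4, sq_nonneg p5]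
      simp [hp3, hp4, hp5]
    · rintro ⟨⟨h4, h5⟩, ⟨h6, h7⟩, h8, h9⟩
      -- Here `1 / 0 = 0` realizes the convention for the quotients.
      simp only [zero_mul, Real.sqrt_zero, mul_zero, sub_zero, div_zero, zero_div, add_zero]
        at h4 h5 h6 h7 h8 h9
      obtain rfl := le_antisymm h5 h4
      obtain rfl := le_antisymm h7 h6
      obtain rfl := le_antisymm h9 h8
      simp
  have hz : 0 < 2 * p1 - p2 := by linarith
  rw [half_sqrt_bounds_iff (mul_pos hp1 hz).le, half_sqrt_bounds_iff (mul_pos hp1 hz).le]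
  constructor
  · rintro ⟨h4, h5⟩
    obtain ⟨hx, hy, hu, hv⟩ := minors_nonneg_of_invariants_nonneg (x := p5) (y := p1 - p5)
      (by linarith) hz (by linarith) h5
    have hD : 0 ≤ (2 * p1 ^ 2 - p1 * p2 - 4 * p3 ^ 2) * (2 * p1 ^ 2 - p1 * p2 - 4 * p4 ^ 2) := by
      nlinarith [sq_nonneg ((2 * p1 - p2) * (2 * p5 - p1) - 2 * (2 * p3 * p4)),
        mul_nonneg hz.le h5]
    have hsum : 0 ≤ (2 * p1 ^ 2 - p1 * p2 - 4 * p3 ^ 2) + (2 * p1 ^ 2 - p1 * p2 - 4 * p4 ^ 2) := by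
      nlinarith
    -- Two factors with nonnegative product and nonnegative sum.
    have hmem : 0 ≤ 2 * p1 ^ 2 - p1 * p2 - 4 * p3 ^ 2 ∧ 0 ≤ 2 * p1 ^ 2 - p1 * p2 - 4 * p4 ^ 2 := by
      rcases mul_nonneg_iff.1 hD with h | h
      · exact h
      · constructor <;> linarith [h.1, h.2]
    refine ⟨by linarith [hmem.1], by linarith [hmem.2], ?_⟩
    rw [half_sqrt_interval_iff hz hD]
    nlinarith [mul_nonneg hz.le h5]
  · rintro ⟨h4, h5, h6⟩
    have h4' : 0 ≤ 2 * p1 ^ 2 - p1 * p2 - 4 * p3 ^ 2 := by linarith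
    have h5' : 0 ≤ 2 * p1 ^ 2 - p1 * p2 - 4 * p4 ^ 2 := by linarith
    rw [half_sqrt_interval_iff hz (mul_nonneg h4' h5')] at h6
    have h7 : 0 ≤ p5 * (p1 - p5) * (2 * p1 - p2) - (p4 - p3) ^ 2 * p5
        - (p3 + p4) ^ 2 * (p1 - p5) := by
      refine nonneg_of_mul_nonneg_right (a := 2 * p1 - p2) ?_ hz
      linarith
    -- The concave quadratic in `h7` is nonpositive at `p5 = 0` and `p5 = p1`, with slopes `z * p1 +
    -- 4p3p4 ≥ 0` and `-z * p1 + 4p3p4 ≤ 0`; so it is negative outside `[0, p1]`.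
    have hslope : 4 * |p3 * p4| ≤ (2 * p1 - p2) * p1 := by
      rcases abs_cases (p3 * p4) with h | h <;> rw [h.1] <;>
        nlinarith [sq_nonneg (p3 - p4), sq_nonneg (p3 + p4)]
    obtain ⟨hs1, hs2⟩ := abs_le.1 (show |p3 * p4| ≤ (2 * p1 - p2) * p1 / 4 by linarith)
    have hx : 0 ≤ p5 := by
      by_contra! hneg
      nlinarith [mul_pos hz (mul_pos_of_neg_of_neg hneg hneg),
        mul_nonneg (sq_nonneg (p3 + p4)) hp1.le]
    have hy : 0 ≤ p1 - p5 := by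
      by_contra! hneg
      nlinarith [mul_pos hz (mul_pos_of_neg_of_neg hneg hneg),
        mul_nonneg (sq_nonneg (p4 - p3)) hp1.le]
    exact ⟨by nlinarith [mul_nonneg hx hy], h7⟩

end Algebra

/-! ### The Hamiltonian in the product basis -/

section Energy

variable {N : ℕ}

/-- Dirac's exchange identity, which makes the Hamiltonian a real combination of transpositions. -/
theorem spinDot_apply_of_ne {μ ν : Site N} (h : μ ≠ ν) (ψ : State N) (σ : Config N) :
    spinDot μ ν ψ σ = 1 / 2 * ψ (σ ∘ Equiv.swap μ ν) - 1 / 4 * ψ σ := by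
  have hs : σ ∘ Equiv.swap μ ν = Function.update (Function.update σ μ (σ ν)) ν (σ μ) := by
    funext κ
    by_cases h1 : κ = ν
    · subst h1; simp
    · by_cases h2 : κ = μ
      · subst h2; simp [h1]
      · simp [h1, h2, Equiv.swap_apply_of_ne_of_ne]
  have hid : Function.update (Function.update σ μ (σ μ)) ν (σ ν) = σ := by simp
  rw [hs, show ψ σ = ψ (Function.update (Function.update σ μ (σ μ)) ν (σ ν)) by rw [hid]]
  simp only [spinDot, spin, siteOp, LinearMap.add_apply, LinearMap.comp_apply, LinearMap.coe_mk,
    AddHom.coe_mk, Fin.sum_univ_three, PiLp.add_apply, Fin.sum_univ_two,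
    Function.update_of_ne h.symm]
  generalize σ μ = a
  generalize σ ν = b
  fin_cases a <;> fin_cases b <;> simp [spinMatrix] <;> ring_nf <;> simp <;> ring

theorem spinDot_self_apply (μ : Site N) (ψ : State N) (σ : Config N) :
    spinDot μ μ ψ σ = 3 / 4 * ψ σ := by
  have hid : Function.update σ μ (σ μ) = σ := by simp
  rw [show ψ σ = ψ (Function.update σ μ (σ μ)) by rw [hid]]
  simp only [spinDot, spin, siteOp, LinearMap.add_apply, LinearMap.comp_apply, LinearMap.coe_mk,
    AddHom.coe_mk, Fin.sum_univ_three, PiLp.add_apply, Fin.sum_univ_two,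
    Function.update_self, Function.update_idem]
  generalize σ μ = a
  fin_cases a <;> simp [spinMatrix] <;> ring_nf <;> simp <;> ring

/-- The spin configuration with prescribed values on the four sites of two dimers. -/
def config (a b c d : Fin 2) : Config 2 := fun μ => ![![a, b], ![c, d]] μ.1 μ.2

theorem sum_config {M : Type*} [AddCommMonoid M] (G : Config 2 → M) :
    ∑ σ, G σ = ∑ a, ∑ b, ∑ c, ∑ d, G (config a b c d) := by
  let e : Fin 2 × Fin 2 × Fin 2 × Fin 2 ≃ Config 2 :=
    { toFun := fun t => config t.1 t.2.1 t.2.2.1 t.2.2.2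
      invFun := fun σ => (σ (0, 0), σ (0, 1), σ (1, 0), σ (1, 1))
      left_inv := fun t => rfl
      right_inv := fun σ => by
        funext ⟨i, j⟩
        fin_cases i <;> fin_cases j <;> rfl }
  rw [← e.sum_comp]
  simp only [Fintype.sum_prod_type]
  rfl

theorem config_comp_swap (a b c d : Fin 2) :
    config a b c d ∘ Equiv.swap (0, 0) (0, 1) = config b a c d ∧
    config a b c d ∘ Equiv.swap (0, 0) (1, 0) = config c b a d ∧
    config a b c d ∘ Equiv.swap (0, 0) (1, 1) = config d b c a ∧
    config a b c d ∘ Equiv.swap (0, 1) (1, 0) = config a c b d ∧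
    config a b c d ∘ Equiv.swap (0, 1) (1, 1) = config a d c b ∧
    config a b c d ∘ Equiv.swap (1, 0) (1, 1) = config a b d c := by
  refine ⟨?_, ?_, ?_, ?_, ?_, ?_⟩ <;>
  · funext ⟨i, j⟩
    fin_cases i <;> fin_cases j <;> rfl

theorem spinDot_comm (μ ν : Site N) (ψ : State N) : spinDot μ ν ψ = spinDot ν μ ψ := by
  rcases eq_or_ne μ ν with rfl | h
  · rfl
  · ext σ
    rw [spinDot_apply_of_ne h, spinDot_apply_of_ne h.symm, Equiv.swap_comm]

/-- The energy of a state with real amplitudes `f`. -/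
noncomputable def realEnergy (J01 J02 J03 J12 J13 J23 : ℝ) (f : Fin 2 → Fin 2 → Fin 2 → Fin 2 → ℝ) : ℝ :=
  ∑ a, ∑ b, ∑ c, ∑ d, f a b c d *
    (J01 * (f b a c d - f a b c d / 2) + J02 * (f c b a d - f a b c d / 2)
      + J03 * (f d b c a - f a b c d / 2) + J12 * (f a c b d - f a b c d / 2)
      + J13 * (f a d c b - f a b c d / 2) + J23 * (f a b d c - f a b c d / 2))

theorem hamiltonian_config {J : Matrix (Site 2) (Site 2) ℝ} (hs : J.IsSymm) (ht : J.trace = 0)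
    (ψ : State 2) (a b c d : Fin 2) :
    hamiltonian J ψ (config a b c d) =
      J (0, 0) (0, 1) * (ψ (config b a c d) - ψ (config a b c d) / 2)
      + J (0, 0) (1, 0) * (ψ (config c b a d) - ψ (config a b c d) / 2)
      + J (0, 0) (1, 1) * (ψ (config d b c a) - ψ (config a b c d) / 2)
      + J (0, 1) (1, 0) * (ψ (config a c b d) - ψ (config a b c d) / 2)
      + J (0, 1) (1, 1) * (ψ (config a d c b) - ψ (config a b c d) / 2)
      + J (1, 0) (1, 1) * (ψ (config a b d c) - ψ (config a b c d) / 2) := by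
  obtain ⟨h1, h2, h3, h4, h5, h6⟩ := config_comp_swap a b c d
  have htr : (J (0, 0) (0, 0) + J (0, 1) (0, 1) + (J (1, 0) (1, 0) + J (1, 1) (1, 1)) : ℂ) = 0 := by
    have : J (0, 0) (0, 0) + J (0, 1) (0, 1) + (J (1, 0) (1, 0) + J (1, 1) (1, 1)) = 0 := by
      simpa [Matrix.trace, Fintype.sum_prod_type] using ht
    exact_mod_cast this
  simp only [hamiltonian, LinearMap.add_apply, LinearMap.smul_apply, Fintype.sum_prod_type,
    Fin.sum_univ_two, PiLp.add_apply, PiLp.smul_apply, smul_eq_mul]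
  rw [spinDot_comm (0, 1) (0, 0), spinDot_comm (1, 0) (0, 0), spinDot_comm (1, 1) (0, 0),
    spinDot_comm (1, 0) (0, 1), spinDot_comm (1, 1) (0, 1), spinDot_comm (1, 1) (1, 0),
    hs.apply (0, 0) (0, 1), hs.apply (0, 0) (1, 0), hs.apply (0, 0) (1, 1),
    hs.apply (0, 1) (1, 0), hs.apply (0, 1) (1, 1), hs.apply (1, 0) (1, 1)]
  simp only [spinDot_self_apply]
  rw [spinDot_apply_of_ne (by decide), spinDot_apply_of_ne (by decide),
    spinDot_apply_of_ne (by decide), spinDot_apply_of_ne (by decide),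
    spinDot_apply_of_ne (by decide), spinDot_apply_of_ne (by decide), h1, h2, h3, h4, h5, h6]
  linear_combination (3 / 4 * ψ (config a b c d)) * htr

theorem energy_eq_realEnergy {J : Matrix (Site 2) (Site 2) ℝ} (hs : J.IsSymm) (ht : J.trace = 0)
    (ψ : State 2) :
    energy J ψ =
      realEnergy (J (0, 0) (0, 1)) (J (0, 0) (1, 0)) (J (0, 0) (1, 1)) (J (0, 1) (1, 0))
        (J (0, 1) (1, 1)) (J (1, 0) (1, 1)) (fun a b c d => (ψ (config a b c d)).re)
      + realEnergy (J (0, 0) (0, 1)) (J (0, 0) (1, 0)) (J (0, 0) (1, 1)) (J (0, 1) (1, 0))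
        (J (0, 1) (1, 1)) (J (1, 0) (1, 1)) (fun a b c d => (ψ (config a b c d)).im) := by
  simp only [energy, PiLp.inner_apply, sum_config, hamiltonian_config hs ht, realEnergy,
    ← Finset.sum_add_distrib, Complex.re_sum]
  refine Finset.sum_congr rfl fun a _ => Finset.sum_congr rfl fun b _ =>
    Finset.sum_congr rfl fun c _ => Finset.sum_congr rfl fun d _ => ?_
  have hre : ∀ (r : ℝ) (w : ℂ), ((r : ℂ) * w).re = r * w.re := by simp
  have him : ∀ (r : ℝ) (w : ℂ), ((r : ℂ) * w).im = r * w.im := by simp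
  have h2re : ∀ w : ℂ, (w / 2).re = w.re / 2 := fun w => by simp
  have h2im : ∀ w : ℂ, (w / 2).im = w.im / 2 := fun w => by simp
  simp only [RCLike.inner_apply, Complex.mul_re, Complex.conj_re, Complex.conj_im, Complex.add_re,
    Complex.add_im, Complex.sub_re, Complex.sub_im, hre, him, h2re, h2im]
  ring

theorem norm_sq_eq_sum_config (ψ : State 2) :
    ‖ψ‖ ^ 2 = ∑ a, ∑ b, ∑ c, ∑ d, (ψ (config a b c d)).re ^ 2
      + ∑ a, ∑ b, ∑ c, ∑ d, (ψ (config a b c d)).im ^ 2 := by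
  rw [EuclideanSpace.norm_sq_eq]
  simp only [sum_config, ← Finset.sum_add_distrib, Complex.sq_norm, Complex.normSq_apply, ← sq]

/-- Decomposition by total spin: five quintet squares, the singlet orthogonal to Φ, and three
triplet blocks. In a block, `A` and `B` are the amplitudes with one dimer still a singlet, `C` that
of two triplets coupled to spin one. -/
theorem realEnergy_add_eq {J01 J02 J03 J12 J13 J23 : ℝ} (hb : J02 + J13 = J03 + J12)
    (f : Fin 2 → Fin 2 → Fin 2 → Fin 2 → ℝ) :
    realEnergy J01 J02 J03 J12 J13 J23 f
        + 3 / 2 * (J01 + J23) * ∑ a, ∑ b, ∑ c, ∑ d, f a b c d ^ 2 =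
      (2 * (J01 + J23) + (J02 + J13)) *
        (f 0 0 0 0 ^ 2 + f 1 1 1 1 ^ 2
          + (f 1 0 0 0 + f 0 1 0 0 + f 0 0 1 0 + f 0 0 0 1) ^ 2 / 4
          + (f 0 1 1 1 + f 1 0 1 1 + f 1 1 0 1 + f 1 1 1 0) ^ 2 / 4
          + (f 0 0 1 1 + f 1 1 0 0 + f 0 1 0 1 + f 0 1 1 0 + f 1 0 0 1 + f 1 0 1 0) ^ 2 / 6)
      + 2 / 3 * (J01 + J23 - (J02 + J13)) *
        (f 0 0 1 1 + f 1 1 0 0 - (f 0 1 0 1 + f 0 1 1 0 + f 1 0 0 1 + f 1 0 1 0) / 2) ^ 2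
      + tripletForm J01 J23 (2 * (J01 + J23) - (J02 + J13)) (J02 - J12) (J12 - J13)
          (f 1 0 0 0 - f 0 1 0 0) (f 0 0 0 1 - f 0 0 1 0)
          ((f 0 0 1 0 + f 0 0 0 1 - f 1 0 0 0 - f 0 1 0 0) / 2)
      + tripletForm J01 J23 (2 * (J01 + J23) - (J02 + J13)) (J02 - J12) (J12 - J13)
          (f 0 1 1 1 - f 1 0 1 1) (f 1 1 1 0 - f 1 1 0 1)
          ((f 1 1 0 1 + f 1 1 1 0 - f 0 1 1 1 - f 1 0 1 1) / 2)
      + 1 / 2 * tripletForm J01 J23 (2 * (J01 + J23) - (J02 + J13)) (J02 - J12) (J12 - J13)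
          (f 1 0 0 1 + f 1 0 1 0 - f 0 1 0 1 - f 0 1 1 0)
          (f 1 0 0 1 + f 0 1 0 1 - f 1 0 1 0 - f 0 1 1 0) (f 0 0 1 1 - f 1 1 0 0) := by
  obtain rfl : J03 = J02 + J13 - J12 := by linarith
  simp only [realEnergy, Fin.sum_univ_two, tripletForm]
  ring

/-! ### The ground-state criterion -/

theorem dimerizedState_config (a b c d : Fin 2) :
    dimerizedState 2 (config a b c d) = singlet a b * singlet c d := by
  simp [dimerizedState, config]

theorem dimerizedState_config_eq_ofReal (a b c d : Fin 2) :
    dimerizedState 2 (config a b c d) =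
      ((!![0, 1; -1, 0] a b * !![0, 1; -1, 0] c d / 2 : ℝ) : ℂ) := by
  have h : (√2 : ℂ) * √2 = 2 := by
    rw [← Complex.ofReal_mul, Real.mul_self_sqrt (by norm_num)]; simp
  have h' : (√2 : ℂ)⁻¹ * (√2 : ℂ)⁻¹ = 1 / 2 := by rw [← mul_inv, h]; simp
  rw [dimerizedState_config]
  fin_cases a <;> fin_cases b <;> fin_cases c <;> fin_cases d <;>
    simp [singlet, neg_div, h']

theorem norm_dimerizedState : ‖dimerizedState 2‖ = 1 := by
  have h : ‖dimerizedState 2‖ ^ 2 = 1 := by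
    rw [norm_sq_eq_sum_config]
    simp only [dimerizedState_config_eq_ofReal, Complex.ofReal_re, Complex.ofReal_im]
    simp [Fin.sum_univ_two]
    norm_num
  exact (pow_eq_one_iff_of_nonneg (norm_nonneg _) two_ne_zero).1 h

variable {J : Matrix (Site 2) (Site 2) ℝ}

theorem balanced_two (hJ : J ∈ balancedSystems 2) :
    J (0, 0) (1, 0) + J (0, 1) (1, 1) = J (0, 0) (1, 1) + J (0, 1) (1, 0) :=
  hJ.2.2.2 0 1 (by decide)

theorem energy_dimerizedState (hJ : J ∈ balancedSystems 2) :
    energy J (dimerizedState 2) = -(3 / 2) * (J (0, 0) (0, 1) + J (1, 0) (1, 1)) := by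
  rw [energy_eq_realEnergy hJ.1 hJ.2.1]
  simp only [dimerizedState_config_eq_ofReal, Complex.ofReal_re, Complex.ofReal_im]
  simp [realEnergy, Fin.sum_univ_two]
  linarith [balanced_two hJ]

theorem mem_dgsSystems_iff (hJ : J ∈ balancedSystems 2) :
    J ∈ dgsSystems 2 ↔ ∀ f : Fin 2 → Fin 2 → Fin 2 → Fin 2 → ℝ,
      0 ≤ realEnergy (J (0, 0) (0, 1)) (J (0, 0) (1, 0)) (J (0, 0) (1, 1)) (J (0, 1) (1, 0))
          (J (0, 1) (1, 1)) (J (1, 0) (1, 1)) f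
        + 3 / 2 * (J (0, 0) (0, 1) + J (1, 0) (1, 1)) *
          ∑ a, ∑ b, ∑ c, ∑ d, f a b c d ^ 2 := by
  constructor
  · intro h f
    set ψ : State 2 := WithLp.toLp 2 fun σ =>
      (f (σ (0, 0)) (σ (0, 1)) (σ (1, 0)) (σ (1, 1)) : ℂ) with hψ
    have hval : ∀ a b c d, ψ (config a b c d) = f a b c d := fun a b c d => rfl
    have hhom : energy J (dimerizedState 2) * ‖ψ‖ ^ 2 ≤ energy J ψ := by
      rcases eq_or_ne ψ 0 with h0 | h0
      · simp [h0, energy]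
      have hn : ‖ψ‖ ≠ 0 := norm_ne_zero_iff.2 h0
      have h1 := h (((‖ψ‖⁻¹ : ℝ) : ℂ) • ψ) (by simp [norm_smul, hn])
      have h2 : energy J (((‖ψ‖⁻¹ : ℝ) : ℂ) • ψ) = ‖ψ‖⁻¹ ^ 2 * energy J ψ := by
        simp only [energy, map_smul, inner_smul_left, inner_smul_right, Complex.conj_ofReal,
          Complex.re_ofReal_mul]
        ring
      rw [h2, inv_pow, inv_mul_eq_div, le_div_iff₀ (by positivity)] at h1
      exact h1
    rw [energy_dimerizedState hJ, norm_sq_eq_sum_config, energy_eq_realEnergy hJ.1 hJ.2.1] at hhom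
    simp only [hval, Complex.ofReal_re, Complex.ofReal_im] at hhom
    simp only [realEnergy, Fin.sum_univ_two] at hhom ⊢
    linarith
  · intro h ψ hψ
    have h1 := h fun a b c d => (ψ (config a b c d)).re
    have h2 := h fun a b c d => (ψ (config a b c d)).im
    have h3 := norm_sq_eq_sum_config ψ
    rw [hψ, one_pow] at h3
    rw [energy_dimerizedState hJ, energy_eq_realEnergy hJ.1 hJ.2.1]
    linear_combination h1 + h2 - 3 / 2 * (J (0, 0) (0, 1) + J (1, 0) (1, 1)) * h3

theorem mem_dgsSystems_iff_tripletForm (hJ : J ∈ balancedSystems 2) :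
    J ∈ dgsSystems 2 ↔
      0 ≤ J (0, 0) (0, 1) + J (1, 0) (1, 1) - (J (0, 0) (1, 0) + J (0, 1) (1, 1)) ∧
      0 ≤ 2 * (J (0, 0) (0, 1) + J (1, 0) (1, 1)) + (J (0, 0) (1, 0) + J (0, 1) (1, 1)) ∧
      ∀ A B C, 0 ≤ tripletForm (J (0, 0) (0, 1)) (J (1, 0) (1, 1))
        (2 * (J (0, 0) (0, 1) + J (1, 0) (1, 1)) - (J (0, 0) (1, 0) + J (0, 1) (1, 1)))
        (J (0, 0) (1, 0) - J (0, 1) (1, 0)) (J (0, 1) (1, 0) - J (0, 1) (1, 1)) A B C := by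
  rw [mem_dgsSystems_iff hJ]
  simp only [realEnergy_add_eq (balanced_two hJ)]
  constructor
  · intro h
    refine ⟨?_, ?_, fun A B C => ?_⟩
    -- The singlet orthogonal to Φ.
    · have := h ![![![![0, 0], ![0, 2]], ![![0, -1], ![-1, 0]]],
        ![![![0, -1], ![-1, 0]], ![![2, 0], ![0, 0]]]]
      simp [tripletForm] at this
      linarith
    -- The fully polarized state.
    · have := h ![![![![1, 0], ![0, 0]], 0], 0]
      simp [tripletForm] at this
      linarith
    -- One flipped spin; the amplitudes sum to zero, killing the quintet part, and have block
    -- coordinates `A`, `B`, `C`.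
    · have := h ![![![![0, (B - -C) / 2], ![(C - B) / 2, 0]], ![![(-C - A) / 2, 0], 0]],
        ![![![(A - C) / 2, 0], 0], 0]]
      simp [tripletForm] at this
      unfold tripletForm
      ring_nf at this ⊢
      linarith
  · rintro ⟨h1, h2, h3⟩ f
    refine add_nonneg (add_nonneg (add_nonneg (add_nonneg (mul_nonneg h2 ?_) (mul_nonneg ?_ ?_))
      (h3 _ _ _)) (h3 _ _ _)) (mul_nonneg ?_ (h3 _ _ _)) <;> positivity

end Energy
end SpinDimers

theorem proposition4 (J : Matrix (SpinDimers.Site 2) (SpinDimers.Site 2) ℝ)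
    (hJ : J ∈ SpinDimers.balancedSystems 2) :
    let J01 : ℝ := J (0, 0) (0, 1)
    let J02 : ℝ := J (0, 0) (1, 0)
    let J12 : ℝ := J (0, 1) (1, 0)
    let J13 : ℝ := J (0, 1) (1, 1)
    let J23 : ℝ := J (1, 0) (1, 1)
    let p1 : ℝ := J01 + J23
    let p2 : ℝ := J02 + J13
    let p3 : ℝ := J12 - p2 / 2
    let p4 : ℝ := J02 - p2 / 2
    let p5 : ℝ := J01
    let R : ℝ := Real.sqrt ((2 * p1 ^ 2 - p1 * p2 - 4 * p3 ^ 2) * (2 * p1 ^ 2 - p1 * p2 - 4 * p4 ^ 2))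
    List.TFAE
      [J ∈ SpinDimers.dgsSystems 2,
       (0 ≤ J01 + J23 - J02 - J13 ∧
        0 ≤ 2 * (J01 + J23) + J02 + J13 ∧
        0 ≤ 2 * J01 ^ 2 * J23 - (J12 - J13) ^ 2 * J23
              - J01 * ((J02 - J12) ^ 2 + (J02 + J13) * J23 - 2 * J23 ^ 2) ∧
        0 ≤ 2 * (J01 ^ 2 + J12 * (J02 + J13) + J23 ^ 2) - J02 ^ 2 - 2 * J12 ^ 2 - J13 ^ 2
              - J01 * (J02 + J13 - 6 * J23) - (J02 + J13) * J23),
       (0 ≤ p1 ∧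
        (-2 * p1 ≤ p2 ∧ p2 ≤ p1) ∧
        (-(1 / 2) * Real.sqrt (p1 * (2 * p1 - p2)) ≤ p3 ∧
          p3 ≤ 1 / 2 * Real.sqrt (p1 * (2 * p1 - p2))) ∧
        (-(1 / 2) * Real.sqrt (p1 * (2 * p1 - p2)) ≤ p4 ∧
          p4 ≤ 1 / 2 * Real.sqrt (p1 * (2 * p1 - p2))) ∧
        p1 / 2 + 1 / (2 * p1 - p2) * (2 * p3 * p4 - 1 / 2 * R) ≤ p5 ∧
        p5 ≤ p1 / 2 + 1 / (2 * p1 - p2) * (2 * p3 * p4 + 1 / 2 * R))] := by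
  intro J01 J02 J12 J13 J23 p1 p2 p3 p4 p5 R
  tfae_have 1 ↔ 2 := by
    rw [SpinDimers.mem_dgsSystems_iff_tripletForm hJ]
    constructor
    · rintro ⟨h1, h2, h⟩
      obtain ⟨h3, h4⟩ := (SpinDimers.tripletForm_nonneg_iff (by linarith) (by linarith)
        (by linarith)).1 h
      exact ⟨by linarith, by linarith, by linarith, by linarith⟩
    · rintro ⟨h1, h2, h3, h4⟩
      exact ⟨by linarith, by linarith, (SpinDimers.tripletForm_nonneg_iff (by linarith)
        (by linarith) (by linarith)).2 ⟨by linarith, by linarith⟩⟩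
  tfae_have 2 ↔ 3 := by
    constructor
    · rintro ⟨h1, h2, h3, h4⟩
      have h := (SpinDimers.invariants_nonneg_iff_parametric (p1 := J01 + J23) (p2 := J02 + J13)
        (p3 := J12 - (J02 + J13) / 2) (p4 := J02 - (J02 + J13) / 2) (p5 := J01)
        (by linarith) (by linarith) (by linarith)).1 ⟨by linarith, by linarith⟩
      exact ⟨show 0 ≤ J01 + J23 by linarith, ⟨show -2 * (J01 + J23) ≤ J02 + J13 by linarith,
        show J02 + J13 ≤ J01 + J23 by linarith⟩, h⟩
    · rintro ⟨h1, ⟨h2, h3⟩, h⟩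
      obtain ⟨h4, h5⟩ := (SpinDimers.invariants_nonneg_iff_parametric h1 h3 h2).2 h
      simp only [p1, p2, p3, p4, p5] at h1 h2 h3 h4 h5
      exact ⟨by linarith, by linarith, by linarith, by linarith⟩
  tfae_finish
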